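/- Let $T>0$, let $(X,\langle\cdot,\cdot\rangle)$ be a real Hilbert space, and let $\varphi:X\to X$ be a homeomorphism with $\varphi(0)=0$ such that $\varphi^{-1}$ is Lipschitz continuous and $$\langle \varphi(x)-\varphi(y),\,x-y\rangle>0\qquad\text{for all }x,y\in X,\ x\neq y.$$ Let $f:[0,T]\times X\times X\to X$ be completely continuous, that is, continuous and mapping bounded subsets of $[0,T]\times X\times X$ to relatively compact subsets of $X$. Assume that there is a continuous function $h:[0,T]\to[0,\infty)$ such that $$\|f(t,x,y)\|\le\langle f(t,x,y),x\rangle+h(t)\qquad\text{for all }(t,x,y)\in[0,T]\times X\times X.$$ Then the boundary value problem $$(\varphi(u'))'=f(t,u,u'),\qquad u(T)=0=u'(0),$$ has at least one solution, that is, there is a function $u:[0,T]\to X$ of class $C^1$ such that $t\mapsto\varphi(u'(t))$ is continuously differentiable on $[0,T]$, $(\varphi(u'(t)))'=f(t,u(t),u'(t))$ for all $t\in[0,T]$, and $u(T)=0=u'(0)$. -/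

import Mathlib

/-- `F` is completely continuous on `D`: it is continuous on `D` and sends bounded subsets of `D`
to relatively compact sets. -/
def IsCompletelyContinuousOn {E Y : Type*} [PseudoMetricSpace E] [TopologicalSpace Y]
    (F : E → Y) (D : Set E) : Prop :=
  ContinuousOn F D ∧ ∀ B ⊆ D, Bornology.IsBounded B → IsCompact (closure (F '' B))

/-- `u` is a solution on `[0, T]` of the boundary value problem
`(φ(u'))' = f(t, u, u')`, `u(T) = 0 = u'(0)`: `u` is of class `C¹` on `[0, T]`, the function
`t ↦ φ(u'(t))` is of class `C¹` on `[0, T]`, the equation holds at every `t ∈ [0, T]`, and the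
boundary conditions hold. Derivatives are relative to `[0, T]`, that is, one-sided at the
endpoints. -/
structure IsBVPSolution {X : Type*} [NormedAddCommGroup X] [NormedSpace ℝ X]
    (T : ℝ) (φ : X → X) (f : ℝ × X × X → X) (u : ℝ → X) : Prop where
  contDiffOn : ContDiffOn ℝ 1 u (Set.Icc 0 T)
  contDiffOn_comp :
    ContDiffOn ℝ 1 (fun t => φ (derivWithin u (Set.Icc 0 T) t)) (Set.Icc 0 T)
  equation : ∀ t ∈ Set.Icc (0 : ℝ) T,
    derivWithin (fun s => φ (derivWithin u (Set.Icc 0 T) s)) (Set.Icc 0 T) t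
      = f (t, u t, derivWithin u (Set.Icc 0 T) t)
  right_boundary : u T = 0
  left_boundary : derivWithin u (Set.Icc 0 T) 0 = 0

open MeasureTheory Metric Set Polynomial
open scoped Manifold ContDiff

/-! Take `w = u'` as the unknown. With `P` the primitive vanishing at `0`, the condition at `T`
gives `u = P w - (P w)(T)`, and the problem becomes `w = F w`, where `F w = φ⁻¹(P (N w))` and `N w =
f(t, u, w)`. Since `f` is compact and primitives gain equicontinuity, `F` sends balls of `C([0,T],
X)` into compact sets (`exists_isCompact_primitive_mem`).

If `w = c • F w` with `0 ≤ c ≤ 1`, put `g = N w` and `v = P g`. As `v(0) = 0 = u(T)`, integrating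
`⟪v, u⟫'` gives `∫⟪v, w⟫ + ∫⟪g, u⟫ = 0`. Monotonicity makes the first term nonnegative, so the
growth condition yields `‖v‖ ≤ ∫‖g‖ ≤ ∫ h`, and the Lipschitz bound gives `‖F w‖ ≤ k ∫ h`. The
Leray–Schauder principle then provides a fixed point. It rests on Schauder's theorem, obtained from
Brouwer's, which follows from the absence of C¹ retractions of the ball onto its sphere. -/

/-! ### No C¹ retraction onto the sphere -/

theorem ContinuousLinearMap.exists_polynomial_det_one_add_smul {E : Type*} [NormedAddCommGroup E]
    [NormedSpace ℝ E] [FiniteDimensional ℝ E] (A : E →L[ℝ] E) :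
    ∃ q : ℝ[X], q.natDegree ≤ Module.finrank ℝ E ∧
      ∀ t : ℝ, (1 + t • A : E →L[ℝ] E).det = q.eval t := by
  let b := Module.finBasis ℝ E
  let M := LinearMap.toMatrix b b (A : E →ₗ[ℝ] E)
  refine ⟨((X : ℝ[X]) • M.map C + (1 : Matrix _ _ ℝ).map C).det, ?_, fun t => ?_⟩
  · simpa using Polynomial.natDegree_det_X_add_C_le M 1
  · rw [← Polynomial.coe_evalRingHom, RingHom.map_det]
    have : (1 + t • A : E →L[ℝ] E).det
        = LinearMap.det ((1 : E →ₗ[ℝ] E) + t • (A : E →ₗ[ℝ] E)) := rfl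
    rw [this, ← LinearMap.det_toMatrix b, map_add, map_smul, LinearMap.toMatrix_one]
    congr 1
    ext i j
    simp [M, Matrix.one_apply, add_comm, apply_ite, mul_comm t]

/-- Along `1 + s • A` every operator is invertible by Neumann series, so the determinant keeps the
sign it has at `s = 0`. -/
theorem ContinuousLinearMap.det_one_add_pos_of_norm_lt_one {E : Type*} [NormedAddCommGroup E]
    [NormedSpace ℝ E] [FiniteDimensional ℝ E] (A : E →L[ℝ] E) (hA : ‖A‖ < 1) :
    0 < (1 + A : E →L[ℝ] E).det := by
  have : CompleteSpace E := FiniteDimensional.complete ℝ E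
  have hne : ∀ s ∈ Icc (0 : ℝ) 1, (1 + s • A : E →L[ℝ] E).det ≠ 0 := by
    intro s hs h0
    have h1 : ‖-(s • A)‖ < 1 := by
      rw [norm_neg, norm_smul, Real.norm_of_nonneg hs.1]
      nlinarith [hs.1, hs.2, norm_nonneg A]
    have hu : IsUnit (1 + s • A : E →L[ℝ] E) := by
      simpa using isUnit_one_sub_of_norm_lt_one h1
    have hu' := LinearMap.isUnit_det _ (hu.map (ContinuousLinearMap.toLinearMapRingHom
      (R₁ := ℝ) (M₁ := E)))
    exact hu'.ne_zero h0
  by_contra! hle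
  have hc : ContinuousOn (fun s : ℝ => (1 + s • A : E →L[ℝ] E).det) (Icc 0 1) :=
    (ContinuousLinearMap.continuous_det.comp (by fun_prop)).continuousOn
  have := intermediate_value_Icc' zero_le_one hc
  obtain ⟨s, hs, hs0⟩ := this (show (0 : ℝ) ∈ _ from ⟨by simpa using hle, by
    simp [ContinuousLinearMap.det]⟩)
  exact hne s hs hs0

section
variable {E : Type*} [NormedAddCommGroup E] [InnerProductSpace ℝ E] [FiniteDimensional ℝ E]
  [MeasurableSpace E] [BorelSpace E]

/-- For small `t`, `id + t • G` is a bijection of `E` fixing the complement of the ball, so it maps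
the ball onto itself; change variables. -/
theorem integral_det_one_add_smul_eq_of_lipschitz {G : E → E} {L : NNReal}
    (hG : LipschitzWith L G) (hG0 : ∀ x, 1 ≤ ‖x‖ → G x = 0) {D : E → E →L[ℝ] E}
    (hD : ∀ x ∈ ball (0 : E) 1, HasFDerivAt G (D x) x) {t : ℝ} (ht0 : 0 < t) (ht : t * L < 1) :
    ∫ x in ball (0 : E) 1, (1 + t • D x : E →L[ℝ] E).det = volume.real (ball (0 : E) 1) := by
  have : CompleteSpace E := FiniteDimensional.complete ℝ E
  let F : E → E := fun x => x + t • G x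
  have hF : ApproximatesLinearOn F ((ContinuousLinearEquiv.refl ℝ E : E ≃L[ℝ] E) : E →L[ℝ] E)
      univ (t.toNNReal * L) := by
    intro x _ y _
    have : F x - F y - ((ContinuousLinearEquiv.refl ℝ E : E ≃L[ℝ] E) : E →L[ℝ] E) (x - y)
        = t • (G x - G y) := by
      simp only [F, ContinuousLinearEquiv.coe_coe, ContinuousLinearEquiv.coe_refl', id]
      module
    rw [this, norm_smul, Real.norm_of_nonneg ht0.le, NNReal.coe_mul,
      Real.coe_toNNReal t ht0.le, mul_assoc]
    exact mul_le_mul_of_nonneg_left (hG.norm_sub_le x y) ht0.le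
  have hc : Subsingleton E ∨ (t.toNNReal * L : NNReal) <
      ‖((ContinuousLinearEquiv.refl ℝ E).symm : E →L[ℝ] E)‖₊⁻¹ := by
    rcases subsingleton_or_nontrivial E with h | h
    · exact Or.inl h
    · right
      have : ‖((ContinuousLinearEquiv.refl ℝ E).symm : E →L[ℝ] E)‖₊ = 1 := by
        ext
        exact ContinuousLinearMap.norm_id
      rw [this, inv_one, ← NNReal.coe_lt_coe, NNReal.coe_mul, Real.coe_toNNReal t ht0.le]
      exact ht
  have hbij : Function.Bijective F := by
    have := (hF.toHomeomorph F hc).bijective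
    exact this
  have himg : F '' ball 0 1 = ball 0 1 := by
    have h1 : F '' (ball 0 1)ᶜ = (ball 0 1)ᶜ := by
      have : ∀ x ∈ (ball (0 : E) 1)ᶜ, F x = id x := fun x hx => by
        simp [F, hG0 x (by simpa using hx)]
      rw [image_congr this, image_id]
    rw [image_compl_eq hbij] at h1
    exact compl_injective h1
  have hcv := integral_image_eq_integral_abs_det_fderiv_smul volume measurableSet_ball
    (f := F) (f' := fun x => 1 + t • D x)
    (fun x hx => ((hasFDerivAt_id x).add ((hD x hx).const_smul t)).hasFDerivWithinAt)
    hbij.injective.injOn (fun _ => (1 : ℝ))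
  rw [himg] at hcv
  simp only [smul_eq_mul, mul_one, integral_const, MeasurableSet.univ, measureReal_restrict_apply,
    univ_inter] at hcv
  rw [hcv]
  refine setIntegral_congr_fun measurableSet_ball fun x hx => ?_
  refine (abs_of_pos (ContinuousLinearMap.det_one_add_pos_of_norm_lt_one _ ?_)).symm
  rw [norm_smul, Real.norm_of_nonneg ht0.le]
  exact (mul_le_mul_of_nonneg_left ((hD x hx).le_of_lipschitz hG) ht0.le).trans_lt ht

/-- The determinant is polynomial in `t`, so its value at `t = 1` is a fixed linear combination of
values at small `t`, where the integral is already known. -/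
theorem integral_det_one_add_eq_of_lipschitz {G : E → E} {L : NNReal}
    (hG : LipschitzWith L G) (hG0 : ∀ x, 1 ≤ ‖x‖ → G x = 0) {D : E → E →L[ℝ] E}
    (hD : ∀ x ∈ ball (0 : E) 1, HasFDerivAt G (D x) x)
    (hDc : ContinuousOn D (closedBall 0 1)) :
    ∫ x in ball (0 : E) 1, (1 + D x : E →L[ℝ] E).det = volume.real (ball (0 : E) 1) := by
  set n := Module.finrank ℝ E
  let s := Finset.range (n + 1)
  -- Distinct interpolation nodes, all satisfying `v i * L < 1`.
  let v : ℕ → ℝ := fun i => ((L : ℝ) + 1 + i)⁻¹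
  have hv0 : ∀ i, 0 < v i := fun i => by positivity
  have hvL : ∀ i, v i * L < 1 := fun i => by
    rw [inv_mul_lt_iff₀ (by positivity)]
    have : (0 : ℝ) ≤ i := i.cast_nonneg
    linarith
  have hvs : Set.InjOn v s := by
    intro i _ j _ hij
    have := inv_injective hij
    exact_mod_cast add_left_cancel this
  have hlag : ∀ A : E →L[ℝ] E, (1 + A : E →L[ℝ] E).det
      = ∑ i ∈ s, (1 + v i • A : E →L[ℝ] E).det * (Lagrange.basis s v i).eval 1 := by
    intro A
    obtain ⟨q, hqd, hq⟩ := A.exists_polynomial_det_one_add_smul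
    have h1 := Lagrange.eq_interpolate (f := q) hvs (by
      refine lt_of_le_of_lt Polynomial.degree_le_natDegree ?_
      simp only [s, Finset.card_range]
      exact_mod_cast Nat.lt_succ_of_le hqd)
    have h2 := congrArg (Polynomial.eval 1) h1
    rw [Lagrange.interpolate_apply, Polynomial.eval_finsetSum] at h2
    have h3 := hq 1
    rw [one_smul] at h3
    rw [h3, h2]
    simp [hq]
  have hint : ∀ t : ℝ, IntegrableOn (fun x => (1 + t • D x : E →L[ℝ] E).det) (ball 0 1) := by
    intro t
    refine IntegrableOn.mono_set ?_ ball_subset_closedBall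
    refine ContinuousOn.integrableOn_compact (isCompact_closedBall _ _) ?_
    exact ContinuousLinearMap.continuous_det.comp_continuousOn (by fun_prop)
  rw [setIntegral_congr_fun measurableSet_ball fun x _ => hlag (D x), integral_finsetSum _ fun i _ => (hint (v i)).mul_const _]
  simp_rw [integral_mul_const]
  rw [Finset.sum_congr rfl fun i _ => by
    rw [integral_det_one_add_smul_eq_of_lipschitz hG hG0 hD (hv0 i) (hvL i)], ← Finset.mul_sum,
    ← Polynomial.eval_finsetSum, Lagrange.sum_basis hvs ⟨0, by simp [s]⟩]
  simp
end

/-- Extended by zero, `r - id` is Lipschitz, so `det Dr` integrates to the volume of the ball. But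
`det Dr = 0`, since `r` takes values in the sphere. -/
theorem no_contDiffOn_retraction_closedBall {E : Type*} [NormedAddCommGroup E]
    [InnerProductSpace ℝ E] [FiniteDimensional ℝ E] {r : E → E} {U : Set E} (hU : IsOpen U)
    (hBU : closedBall 0 1 ⊆ U) (hr : ContDiffOn ℝ 1 r U)
    (hr1 : ∀ x ∈ closedBall (0 : E) 1, ‖r x‖ = 1) (hrs : ∀ x, ‖x‖ = 1 → r x = x) : False := by
  borelize E
  have hg : ContDiffOn ℝ 1 (fun x => r x - x) U := hr.sub contDiffOn_id
  obtain ⟨L, hL⟩ := (hg.mono hBU).exists_lipschitzOnWith one_ne_zero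
    (convex_closedBall 0 1) (isCompact_closedBall 0 1)
  classical
  let G : E → E := fun x => if ‖x‖ ≤ 1 then r x - x else 0
  have hGL : LipschitzWith L G := by
    have key : ∀ x y, ‖x‖ ≤ 1 → 1 < ‖y‖ → dist (G x) (G y) ≤ L * dist x y := by
      intro x y hx hy
      -- The segment from `x` to `y` crosses the sphere at `z`, where `G` vanishes as it does at
      -- `y`.
      obtain ⟨z, hz1, hz⟩ : ∃ z, ‖z‖ = 1 ∧ dist x z ≤ dist x y := by
        have hc : ContinuousOn (fun s : ℝ => ‖AffineMap.lineMap x y s‖) (Icc 0 1) :=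
          (continuous_norm.comp AffineMap.lineMap_continuous).continuousOn
        obtain ⟨s, hs, hs1⟩ := intermediate_value_Icc zero_le_one hc
          (show (1 : ℝ) ∈ _ from ⟨by simpa using hx, by simpa using hy.le⟩)
        refine ⟨_, hs1, ?_⟩
        rw [dist_left_lineMap, Real.norm_of_nonneg hs.1]
        exact mul_le_of_le_one_left dist_nonneg hs.2
      have h1 : G y = r z - z := by simp [G, hy.not_ge, hrs z hz1]
      have h2 : G x = r x - x := by simp [G, hx]
      rw [h1, h2]
      exact (hL.dist_le_mul x (by simpa using hx) z (by simp [hz1])).trans (by gcongr)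
    refine LipschitzWith.of_dist_le_mul fun x y => ?_
    rcases le_or_gt ‖x‖ 1 with hx | hx <;> rcases le_or_gt ‖y‖ 1 with hy | hy
    · simpa [G, hx, hy] using hL.dist_le_mul x (by simpa using hx) y (by simpa using hy)
    · exact key x y hx hy
    · rw [dist_comm, dist_comm x]; exact key y x hy hx
    · simp only [G, hx.not_ge, hy.not_ge, if_false, dist_self]; positivity
  have hG0 : ∀ x, 1 ≤ ‖x‖ → G x = 0 := by
    intro x hx
    rcases hx.eq_or_lt with h | h
    · simp [G, hrs x h.symm]
    · simp [G, h.not_ge]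
  have hrd : ∀ x ∈ ball (0 : E) 1, HasFDerivAt r (fderiv ℝ r x) x := fun x hx =>
    ((hr.contDiffAt (hU.mem_nhds (hBU (ball_subset_closedBall hx)))).differentiableAt
      one_ne_zero).hasFDerivAt
  have hD : ∀ x ∈ ball (0 : E) 1, HasFDerivAt G (fderiv ℝ r x - 1) x := by
    intro x hx
    refine ((hrd x hx).sub (hasFDerivAt_id x)).congr_of_eventuallyEq ?_
    filter_upwards [isOpen_ball.mem_nhds hx] with y hy
    have : ‖y‖ ≤ 1 := by simpa using (ball_subset_closedBall hy)
    simp [G, this]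
  have h1 := integral_det_one_add_eq_of_lipschitz hGL hG0 hD
    (((hr.continuousOn_fderiv_of_isOpen hU le_rfl).mono hBU).sub continuousOn_const)
  have h2 : ∀ x ∈ ball (0 : E) 1, (1 + (fderiv ℝ r x - 1) : E →L[ℝ] E).det = 0 := by
    intro x hx
    rw [add_sub_cancel]
    by_contra hne
    have hsurj : Function.Surjective (fderiv ℝ r x) := by
      exact (LinearMap.equivOfDetNeZero (fderiv ℝ r x : E →ₗ[ℝ] E) hne).surjective
    -- Differentiating `‖r‖² = 1` along this `v` gives `2‖r x‖² = 0`.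
    obtain ⟨v, hv⟩ := hsurj (r x)
    have hconst : (fun y => ‖r y‖ ^ 2) =ᶠ[nhds x] fun _ => (1 : ℝ) := by
      filter_upwards [isOpen_ball.mem_nhds hx] with y hy
      simp [hr1 y (ball_subset_closedBall hy)]
    have hd := ((hrd x hx).norm_sq).congr_of_eventuallyEq hconst.symm
    have := congrArg (fun A : E →L[ℝ] ℝ => A v) (hd.unique (hasFDerivAt_const _ _))
    simp [hv, hr1 x (ball_subset_closedBall hx)] at this
  rw [setIntegral_congr_fun measurableSet_ball h2] at h1
  simp only [integral_zero] at h1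
  have := Metric.measure_ball_pos (volume : Measure E) 0 one_pos
  have h3 : 0 < volume.real (ball (0 : E) 1) :=
    ENNReal.toReal_pos this.ne' measure_ball_lt_top.ne
  exact h3.ne h1

/-! ### Brouwer's theorem on the ball and the simplex -/

theorem exists_fixedPoint_of_contDiff_mapsTo_closedBall {E : Type*} [NormedAddCommGroup E]
    [InnerProductSpace ℝ E] [FiniteDimensional ℝ E] {g : E → E} (hg : ContDiff ℝ 1 g)
    (hgB : MapsTo g (closedBall 0 1) (closedBall 0 1)) : ∃ x ∈ closedBall (0 : E) 1, g x = x := by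
  by_contra! hne
  let a : E → ℝ := fun x => ‖x - g x‖ ^ 2
  let b : E → ℝ := fun x => inner ℝ x (x - g x)
  let c : E → ℝ := fun x => 1 - ‖x‖ ^ 2
  -- The larger root of `a s² + 2 b s = c`: it is where the ray from `g x` through `x` leaves the
  -- ball. On the sphere `c = 0 < b`, so `s = 0`.
  let s : E → ℝ := fun x => (-b x + √(b x ^ 2 + a x * c x)) / a x
  have hd : ContDiff ℝ 1 fun x => x - g x := contDiff_id.sub hg
  have ha : ContDiff ℝ 1 a := hd.norm_sq ℝ
  have hb : ContDiff ℝ 1 b := contDiff_id.inner ℝ hd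
  have hc : ContDiff ℝ 1 c := contDiff_const.sub (contDiff_id.norm_sq ℝ)
  have hΔ : ContDiff ℝ 1 fun x => b x ^ 2 + a x * c x := (hb.pow 2).add (ha.mul hc)
  have hapos : ∀ x ∈ closedBall (0 : E) 1, 0 < a x := fun x hx => by
    have : x - g x ≠ 0 := sub_ne_zero.2 (hne x hx).symm
    positivity
  have hbpos : ∀ x, ‖x‖ = 1 → 0 < b x := fun x hx => by
    have hxB : x ∈ closedBall (0 : E) 1 := by simp [hx]
    have h1 := hapos x hxB
    have h2 : ‖g x‖ ≤ 1 := by simpa using hgB hxB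
    simp only [a, b, norm_sub_sq_real, inner_sub_right, real_inner_self_eq_norm_sq, hx] at h1 ⊢
    nlinarith [norm_nonneg (g x)]
  have hΔpos : ∀ x ∈ closedBall (0 : E) 1, 0 < b x ^ 2 + a x * c x := fun x hx => by
    have hx1 : ‖x‖ ≤ 1 := by simpa using hx
    rcases hx1.eq_or_lt with h | h
    · have := hbpos x h
      simp only [c, h]
      nlinarith
    · have h1 := hapos x hx
      have h2 : 0 < c x := by simp only [c]; nlinarith [norm_nonneg x]
      positivity
  refine no_contDiffOn_retraction_closedBall (r := fun x => x + s x • (x - g x))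
    (U := {x | a x ≠ 0} ∩ {x | 0 < b x ^ 2 + a x * c x})
    ((isOpen_ne_fun ha.continuous continuous_const).inter
      (isOpen_lt continuous_const hΔ.continuous))
    (fun x hx => ⟨(hapos x hx).ne', hΔpos x hx⟩) ?_ ?_ ?_
  · refine contDiffOn_id.add (ContDiffOn.smul ?_ hd.contDiffOn)
    exact (hb.neg.contDiffOn.add (hΔ.contDiffOn.sqrt fun x hx => hx.2.ne')).div ha.contDiffOn
      fun x hx => hx.1
  · intro x hx
    have h0 := hapos x hx
    have h1 : ‖x + s x • (x - g x)‖ ^ 2 = ‖x‖ ^ 2 + 2 * s x * b x + s x ^ 2 * a x := by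
      rw [norm_add_sq_real, norm_smul, mul_pow, Real.norm_eq_abs, sq_abs, real_inner_smul_right]
      simp only [a, b]
      ring
    have h2 : s x * a x = -b x + √(b x ^ 2 + a x * c x) := div_mul_cancel₀ _ h0.ne'
    have h3 := Real.sq_sqrt (hΔpos x hx).le
    have h4 : √(b x ^ 2 + a x * c x) = s x * a x + b x := by linarith
    rw [h4] at h3
    have h5 : a x * (s x ^ 2 * a x + 2 * s x * b x - c x) = 0 := by linarith
    have h6 := (mul_eq_zero.1 h5).resolve_left h0.ne'
    have h7 : ‖x + s x • (x - g x)‖ ^ 2 = 1 := by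
      rw [h1]; simp only [c] at h6; linarith
    exact (pow_eq_one_iff_of_nonneg (norm_nonneg _) two_ne_zero).1 h7
  · intro x hx
    have : s x = 0 := by
      simp [s, c, hx, Real.sqrt_sq (hbpos x hx).le]
    simp [this]

theorem exists_contDiff_dist_lt {E F : Type*} [NormedAddCommGroup E] [NormedSpace ℝ E]
    [FiniteDimensional ℝ E] [NormedAddCommGroup F] [NormedSpace ℝ F] {f : E → F}
    (hf : Continuous f) {ε : ℝ} (hε : 0 < ε) :
    ∃ g : E → F, ContDiff ℝ 1 g ∧ ∀ x, dist (g x) (f x) < ε := by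
  obtain ⟨g, hg⟩ := exists_contMDiffMap_forall_mem_convex_of_local_const (n := 1) 𝓘(ℝ, E)
    (t := fun x => ball (f x) ε) (fun x => convex_ball _ _) (fun x => ⟨f x, by
      filter_upwards [hf.continuousAt.eventually (ball_mem_nhds (f x) hε)] with y hy
      rwa [mem_ball_comm]⟩)
  exact ⟨g, g.contMDiff.contDiff, hg⟩

/-- **Brouwer fixed point theorem** for continuous self-maps with values in the unit ball. -/
theorem exists_fixedPoint_of_continuous_of_norm_le_one {E : Type*} [NormedAddCommGroup E]
    [InnerProductSpace ℝ E] [FiniteDimensional ℝ E] {f : E → E} (hf : Continuous f)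
    (hf1 : ∀ x, ‖f x‖ ≤ 1) : ∃ x, f x = x := by
  by_contra! hne
  obtain ⟨x₀, hx₀, hmin⟩ := (isCompact_closedBall (0 : E) 1).exists_isMinOn
    ⟨0, by simp⟩ (f := fun x => ‖f x - x‖) (by fun_prop)
  have hpos : 0 < ‖f x₀ - x₀‖ := norm_pos_iff.2 (sub_ne_zero.2 (hne x₀))
  -- The fixed point of the rescaled `g` will satisfy `‖f x - x‖ < 2 * ε`, below the minimum `4 *
  -- ε`.
  set ε := ‖f x₀ - x₀‖ / 4 with hε
  have hε0 : 0 < ε := by positivity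
  obtain ⟨g, hg, hgf⟩ := exists_contDiff_dist_lt hf hε0
  obtain ⟨x, hx, hgx⟩ := exists_fixedPoint_of_contDiff_mapsTo_closedBall
    (g := fun x => (1 + ε)⁻¹ • g x) (hg.const_smul _) (by
      intro x _
      have h1 : ‖g x‖ ≤ 1 + ε := by
        have := norm_le_norm_add_norm_sub (f x) (g x)
        have h2 := hgf x
        rw [dist_eq_norm, norm_sub_rev] at h2
        linarith [hf1 x]
      rw [mem_closedBall_zero_iff, norm_smul, Real.norm_of_nonneg (by positivity),
        inv_mul_le_iff₀ (by positivity)]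
      simpa using h1)
  have h1 : g x = x + ε • x := by
    rw [inv_smul_eq_iff₀ (by positivity)] at hgx
    rw [hgx, add_smul, one_smul]
  have h2 := hgf x
  rw [dist_comm, dist_eq_norm, h1] at h2
  have h3 : ‖f x - x‖ ≤ ‖f x - (x + ε • x)‖ + ‖ε • x‖ := by
    refine le_trans (le_of_eq ?_) (norm_add_le _ _)
    congr 1
    abel
  have h4 : ‖ε • x‖ ≤ ε := by
    rw [norm_smul, Real.norm_of_nonneg hε0.le]
    exact mul_le_of_le_one_right hε0.le (by simpa using hx)
  have h5 : ‖f x₀ - x₀‖ ≤ ‖f x - x‖ := hmin hx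
  linarith

theorem exists_continuous_retraction_stdSimplex (ι : Type*) [Fintype ι] [Nonempty ι] :
    ∃ ρ : (ι → ℝ) → ι → ℝ, Continuous ρ ∧ (∀ x, ρ x ∈ stdSimplex ℝ ι) ∧
      ∀ x ∈ stdSimplex ℝ ι, ρ x = x := by
  let S : (ι → ℝ) → ℝ := fun x => ∑ i, max (x i) 0
  have hS : Continuous S := by fun_prop
  have hpos : ∀ x, 0 < max (S x) 1 := fun x => lt_max_of_lt_right one_pos
  -- Take positive parts, spread any deficit of mass evenly, and normalize any excess.
  refine ⟨fun x i => (max (x i) 0 + max (1 - S x) 0 / Fintype.card ι) / max (S x) 1, ?_, ?_, ?_⟩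
  · refine continuous_pi fun i => Continuous.div ?_ ?_ fun x => (hpos x).ne' <;> fun_prop
  · refine fun x => ⟨fun i => ?_, ?_⟩
    · have := hpos x
      positivity
    · rw [← Finset.sum_div, Finset.sum_add_distrib, div_eq_one_iff_eq (hpos x).ne']
      simp only [Finset.sum_const, Finset.card_univ, nsmul_eq_mul]
      rw [mul_div_cancel₀ _ (by positivity)]
      change S x + _ = _
      rcases le_total (S x) 1 with h | h
      · rw [max_eq_left (by linarith), max_eq_right h]; ring
      · rw [max_eq_right (by linarith), max_eq_left h]; ring
  · intro x hx
    have h1 : ∀ i, max (x i) 0 = x i := fun i => max_eq_left (hx.1 i)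
    have h2 : S x = 1 := by simp only [S, h1]; exact hx.2
    ext i
    simp [h1, h2]

theorem exists_fixedPoint_of_mapsTo_stdSimplex {ι : Type*} [Fintype ι] [Nonempty ι]
    {f : (ι → ℝ) → ι → ℝ} (hf : ContinuousOn f (stdSimplex ℝ ι))
    (hfS : MapsTo f (stdSimplex ℝ ι) (stdSimplex ℝ ι)) : ∃ x ∈ stdSimplex ℝ ι, f x = x := by
  obtain ⟨ρ, hρ, hρS, hρid⟩ := exists_continuous_retraction_stdSimplex ι
  have hc : Continuous fun x => f (ρ x) := hf.comp_continuous hρ hρS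
  obtain ⟨x, hx⟩ := exists_fixedPoint_of_continuous_of_norm_le_one
    (E := EuclideanSpace ℝ ι) (f := fun x => WithLp.toLp 2 (f (ρ x.ofLp)))
    ((PiLp.continuous_toLp 2 _).comp (hc.comp (PiLp.continuous_ofLp 2 _))) (by
      intro x
      have h := hfS (hρS x.ofLp)
      rw [EuclideanSpace.norm_eq, Real.sqrt_le_one, ← h.2]
      refine Finset.sum_le_sum fun i _ => ?_
      have h0 := h.1 i
      have h1 : f (ρ x.ofLp) i ≤ 1 := h.2 ▸
        Finset.single_le_sum (fun j _ => h.1 j) (Finset.mem_univ i)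
      simp only [Real.norm_eq_abs, sq_abs]
      nlinarith)
  have hx' : f (ρ x.ofLp) = x.ofLp := congrArg WithLp.ofLp hx
  have hxS : x.ofLp ∈ stdSimplex ℝ ι := hx' ▸ hfS (hρS _)
  refine ⟨x.ofLp, hxS, ?_⟩
  rwa [hρid _ hxS] at hx'

/-! ### Schauder's theorem and the Leray–Schauder principle -/

theorem exists_dist_le_of_mapsTo_isCompact {E : Type*} [NormedAddCommGroup E] [NormedSpace ℝ E]
    {C K : Set E} (hC : Convex ℝ C) (hCne : C.Nonempty) (hK : IsCompact K) (hKC : K ⊆ C)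
    {f : E → E} (hf : ContinuousOn f C) (hfK : MapsTo f C K) {ε : ℝ} (hε : 0 < ε) :
    ∃ x ∈ C, dist (f x) x ≤ ε := by
  obtain ⟨t, htK, hKt⟩ := hK.elim_nhds_subcover (fun y => ball y ε) fun y _ => ball_mem_nhds y hε
  have hw : ∀ z ∈ K, ∃ y : t, dist z y < ε := fun z hz => by
    obtain ⟨y, hy, hzy⟩ := mem_iUnion₂.1 (hKt hz)
    exact ⟨⟨y, hy⟩, hzy⟩
  have : Nonempty t := by
    obtain ⟨x, hx⟩ := hCne
    exact ⟨(hw _ (hfK hx)).choose⟩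
  let w : t → E → ℝ := fun y z => max (ε - dist z y) 0
  let S : E → ℝ := fun z => ∑ y, w y z
  have hw0 : ∀ y z, 0 ≤ w y z := fun y z => le_max_right _ _
  have hwc : ∀ y, Continuous (w y) := fun y => by fun_prop
  have hS : ∀ z ∈ K, 0 < S z := fun z hz => by
    obtain ⟨y, hy⟩ := hw z hz
    exact Finset.sum_pos' (fun y _ => hw0 y z)
      ⟨y, Finset.mem_univ _, lt_max_of_lt_left (by linarith)⟩
  let q : (t → ℝ) → E := fun a => ∑ y, a y • (y : E)
  have hq : Continuous q := by fun_prop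
  have hqC : MapsTo q (stdSimplex ℝ t) C := fun a ha =>
    hC.sum_mem (fun y _ => ha.1 y) ha.2 fun y _ => hKC (htK y y.2)
  have hfq : ContinuousOn (fun a => f (q a)) (stdSimplex ℝ t) := hf.comp hq.continuousOn hqC
  -- Schauder projection in barycentric coordinates: a fixed `a` only weights net points within `ε`
  -- of `f (q a)`, so `q a` is that close too.
  obtain ⟨a, ha, hfix⟩ := exists_fixedPoint_of_mapsTo_stdSimplex
    (f := fun a y => w y (f (q a)) / S (f (q a)))
    (continuousOn_pi.2 fun y => ((hwc y).comp_continuousOn hfq).div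
      ((continuous_finsetSum _ fun y _ => hwc y).comp_continuousOn hfq)
      fun a ha => (hS _ (hfK (hqC ha))).ne')
    (fun a ha => ⟨fun y => div_nonneg (hw0 _ _) (hS _ (hfK (hqC ha))).le, by
      rw [← Finset.sum_div, div_self (hS _ (hfK (hqC ha))).ne']⟩)
  refine ⟨q a, hqC ha, ?_⟩
  have h1 : f (q a) - q a = ∑ y, a y • (f (q a) - (y : E)) := by
    simp only [smul_sub, Finset.sum_sub_distrib, ← Finset.sum_smul, ha.2, one_smul, q]
  rw [dist_eq_norm, h1]
  calc ‖∑ y, a y • (f (q a) - (y : E))‖ ≤ ∑ y, a y * ε := by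
        refine norm_sum_le_of_le _ fun y _ => ?_
        rw [norm_smul, Real.norm_of_nonneg (ha.1 y)]
        rcases le_or_gt ε (dist (f (q a)) y) with h | h
        · have : a y = 0 := by
            rw [← congrFun hfix y]
            simp [w, h]
          simp [this]
        · rw [← dist_eq_norm]
          exact mul_le_mul_of_nonneg_left h.le (ha.1 y)
    _ = ε := by rw [← Finset.sum_mul, ha.2, one_mul]

/-- **Schauder fixed point theorem**. -/
theorem exists_fixedPoint_of_mapsTo_isCompact {E : Type*} [NormedAddCommGroup E]
    [NormedSpace ℝ E] {C K : Set E} (hC : Convex ℝ C) (hCne : C.Nonempty) (hK : IsCompact K)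
    (hKC : K ⊆ C) {f : E → E} (hf : ContinuousOn f C) (hfK : MapsTo f C K) :
    ∃ x ∈ C, f x = x := by
  choose x hxC hx using fun n : ℕ => exists_dist_le_of_mapsTo_isCompact hC hCne hK hKC hf hfK
    (Nat.one_div_pos_of_nat (α := ℝ) (n := n))
  obtain ⟨y, hy, φ, hφ, hlim⟩ := hK.tendsto_subseq fun n => hfK (hxC n)
  have hdist : Filter.Tendsto (fun n => dist (f (x (φ n))) (x (φ n))) Filter.atTop (nhds 0) :=
    squeeze_zero (fun _ => dist_nonneg) (fun n => hx (φ n))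
      (tendsto_one_div_add_atTop_nhds_zero_nat.comp hφ.tendsto_atTop)
  have hxy : Filter.Tendsto (fun n => x (φ n)) Filter.atTop (nhds y) :=
    (tendsto_iff_of_dist hdist).1 hlim
  have hfy := (hf y (hKC hy)).tendsto.comp
    (tendsto_nhdsWithin_iff.2 ⟨hxy, Filter.Eventually.of_forall fun n => hxC (φ n)⟩)
  exact ⟨y, hKC hy, tendsto_nhds_unique hfy hlim⟩

/-- A form of the **Leray–Schauder principle**. -/
theorem exists_fixedPoint_of_norm_le_of_eq_smul {E : Type*} [NormedAddCommGroup E]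
    [NormedSpace ℝ E] {R : ℝ} (hR : 0 < R) {Q : Set E} (hQ : IsCompact Q) {F : E → E}
    (hF : Continuous F) (hFQ : MapsTo F (closedBall 0 R) Q)
    (hbd : ∀ x, ∀ c ∈ Icc (0 : ℝ) 1, x = c • F x → ‖F x‖ ≤ R) : ∃ x, F x = x := by
  -- Radial retraction onto the ball. A fixed point of `r ∘ F` has the form `x = c • F x`, so `hbd`
  -- makes `r` act trivially on `F x`.
  let r : E → E := fun x => (R / max R ‖x‖) • x
  have hm : ∀ x : E, 0 < max R ‖x‖ := fun x => lt_max_of_lt_left hR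
  have hr : Continuous r :=
    (continuous_const.div (by fun_prop) fun x => (hm x).ne').smul continuous_id
  have hrR : ∀ x, r x ∈ closedBall (0 : E) R := fun x => by
    rw [mem_closedBall_zero_iff, norm_smul, Real.norm_of_nonneg (div_pos hR (hm x)).le,
      div_mul_eq_mul_div, div_le_iff₀ (hm x)]
    exact mul_le_mul_of_nonneg_left (le_max_right _ _) hR.le
  obtain ⟨x, -, hx⟩ := exists_fixedPoint_of_mapsTo_isCompact (convex_closedBall (0 : E) R)
    ⟨0, by simp [hR.le]⟩ (hQ.image hr) (image_subset_iff.2 fun x _ => hrR x)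
    (hr.comp hF).continuousOn (fun x hx => mem_image_of_mem r (hFQ hx))
  refine ⟨x, ?_⟩
  have h1 := hbd x (R / max R ‖F x‖)
    ⟨(div_pos hR (hm _)).le, div_le_one_of_le₀ (le_max_left _ _) (hm _).le⟩ hx.symm
  have h2 : r (F x) = F x := by
    simp only [r]
    rw [max_eq_left h1, div_self hR.ne', one_smul]
  exact h2.symm.trans hx

/-! ### The primitive operator and its compactness -/

theorem ContinuousMap.IccExtend_apply_of_mem {X : Type*} [TopologicalSpace X] {a b : ℝ}
    (hab : a ≤ b) (g : C(Icc a b, X)) {t : ℝ} (ht : t ∈ Icc a b) :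
    g.IccExtend hab t = g ⟨t, ht⟩ :=
  Set.IccExtend_of_mem hab g ht

section primitive
variable {X : Type*} [NormedAddCommGroup X] [NormedSpace ℝ X] {T : ℝ}

namespace ContinuousMap

/-- The primitive vanishing at `0` of a continuous function on `[0, T]`, extended to the line by
its boundary values. -/
noncomputable def primitiveExtend (hT : 0 ≤ T) (g : C(Icc 0 T, X)) (t : ℝ) : X :=
  ∫ s in (0)..t, g.IccExtend hT s

variable (hT : 0 ≤ T)

@[simp] theorem primitiveExtend_zero (g : C(Icc 0 T, X)) : g.primitiveExtend hT 0 = 0 :=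
  intervalIntegral.integral_same

theorem norm_primitiveExtend_sub_le {g : C(Icc 0 T, X)} {M : ℝ} (hM : ∀ t, ‖g t‖ ≤ M) (s t : ℝ) :
    ‖g.primitiveExtend hT t - g.primitiveExtend hT s‖ ≤ M * |t - s| := by
  have hc : Continuous (g.IccExtend hT) := (g.IccExtend hT).continuous
  rw [primitiveExtend, primitiveExtend, intervalIntegral.integral_interval_sub_left
    (hc.intervalIntegrable _ _) (hc.intervalIntegrable _ _)]
  exact intervalIntegral.norm_integral_le_of_norm_le_const fun x _ => hM _

theorem hasDerivAt_primitiveExtend [CompleteSpace X] (g : C(Icc 0 T, X)) (t : ℝ) :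
    HasDerivAt (g.primitiveExtend hT) (g.IccExtend hT t) t :=
  ((g.IccExtend hT).continuous.integral_hasStrictDerivAt 0 t).hasDerivAt

theorem continuous_primitiveExtend (g : C(Icc 0 T, X)) : Continuous (g.primitiveExtend hT) :=
  intervalIntegral.continuous_primitive
    (fun _ _ => (g.IccExtend hT).continuous.intervalIntegrable _ _) 0

theorem contDiff_primitiveExtend [CompleteSpace X] (g : C(Icc 0 T, X)) :
    ContDiff ℝ 1 (g.primitiveExtend hT) := by
  rw [contDiff_one_iff_deriv]
  refine ⟨fun t => (g.hasDerivAt_primitiveExtend hT t).differentiableAt, ?_⟩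
  rw [show deriv (g.primitiveExtend hT) = g.IccExtend hT from
    funext fun t => (g.hasDerivAt_primitiveExtend hT t).deriv]
  exact (g.IccExtend hT).continuous

/-- The primitive vanishing at `0`, as a continuous linear operator on `C([0, T], X)`. -/
noncomputable def primitive : C(Icc 0 T, X) →L[ℝ] C(Icc 0 T, X) :=
  LinearMap.mkContinuous
    { toFun := fun g => ⟨fun t => g.primitiveExtend hT t,
        (g.continuous_primitiveExtend hT).comp continuous_subtype_val⟩
      map_add' := fun f g => by
        ext t
        exact intervalIntegral.integral_add ((f.IccExtend hT).continuous.intervalIntegrable _ _)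
          ((g.IccExtend hT).continuous.intervalIntegrable _ _)
      map_smul' := fun c g => by
        ext t
        exact intervalIntegral.integral_smul c (g.IccExtend hT) } T
    (fun g => by
      refine (norm_le _ (by positivity)).2 fun t => ?_
      have h := norm_primitiveExtend_sub_le hT g.norm_coe_le_norm 0 t
      rw [primitiveExtend_zero, sub_zero, sub_zero, abs_of_nonneg t.2.1, mul_comm] at h
      exact h.trans (mul_le_mul_of_nonneg_right t.2.2 (norm_nonneg g)))

@[simp] theorem primitive_apply (g : C(Icc 0 T, X)) (t : Icc 0 T) :
    primitive hT g t = g.primitiveExtend hT t := rfl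

/-- Arzelà–Ascoli: boundedness of `S` makes the primitives equi-Lipschitz, and at `t` each is `t`
times an average, which lies in the compact closed hull of `S`. -/
theorem exists_isCompact_primitive_mem [CompleteSpace X] {S : Set X} (hS : IsCompact S) :
    ∃ Q : Set C(Icc 0 T, X), IsCompact Q ∧
      ∀ g : C(Icc 0 T, X), (∀ t, g t ∈ S) → primitive hT g ∈ Q := by
  let H := closedAbsConvexHull ℝ S
  have hH : IsCompact H := isCompact_closedAbsConvexHull_of_totallyBounded hS.totallyBounded
  have hSH : S ⊆ H := subset_closedAbsConvexHull
  have hHconv : Convex ℝ H := absConvex_convexClosedHull.2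
  have hHcl : IsClosed H := isClosed_closedAbsConvexHull
  obtain ⟨M, hM⟩ := hS.isBounded.exists_norm_le
  let Z : Set X := (fun p : ℝ × X => p.1 • p.2) '' (Icc 0 T ×ˢ H)
  have hZ : IsCompact Z := (isCompact_Icc.prod hH).image (by fun_prop)
  let A : Set C(Icc 0 T, X) := primitive hT '' {g | ∀ t, g t ∈ S}
  let e := isometryEquivBoundedOfCompact (Icc 0 T) X
  have hA : IsCompact (closure (e '' A)) := by
    refine BoundedContinuousFunction.arzela_ascoli Z hZ _ ?_ ?_
    · rintro _ t ⟨_, ⟨g, hg, rfl⟩, rfl⟩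
      change g.primitiveExtend hT t ∈ Z
      rcases t.2.1.eq_or_lt with h0 | h0
      · rw [← h0, primitiveExtend_zero]
        exact ⟨(0, g t), ⟨⟨le_rfl, hT⟩, hSH (hg t)⟩, zero_smul _ _⟩
      · refine ⟨((t : ℝ), ⨍ s in (0)..(t : ℝ), g.IccExtend hT s), ⟨t.2, ?_⟩, ?_⟩
        · rw [uIoc_of_le h0.le]
          refine hHconv.set_average_mem hHcl (by simp [h0]) (by simp)
            (Filter.Eventually.of_forall fun s => hSH (hg _)) ?_
          exact (g.IccExtend hT).continuous.integrableOn_Ioc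
        · simp only [interval_average_eq, sub_zero]
          exact smul_inv_smul₀ h0.ne' _
    · refine Metric.equicontinuous_of_continuity_modulus (fun x => M * x)
        (by simpa using (continuous_const_mul M).tendsto 0) _ ?_
      rintro s t ⟨_, ⟨_, ⟨g, hg, rfl⟩, rfl⟩⟩
      rw [dist_comm, dist_comm s]
      exact (dist_eq_norm _ _).trans_le (norm_primitiveExtend_sub_le hT (fun t => hM _ (hg t)) s t)
  refine ⟨e.symm '' closure (e '' A), hA.image e.symm.continuous, fun g hg => ?_⟩
  exact ⟨e (primitive hT g), subset_closure (mem_image_of_mem e ⟨g, hg, rfl⟩),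
    e.symm_apply_apply _⟩

end ContinuousMap
end primitive

/-! ### A priori bound and the boundary value problem -/

/-- The superposition operator `w ↦ F(t, w(t))` is continuous. -/
theorem ContinuousMap.continuous_superposition {I X Y : Type*} [TopologicalSpace I]
    [LocallyCompactSpace I] [TopologicalSpace X] [TopologicalSpace Y] {F : I × X → Y}
    (hF : Continuous F) :
    Continuous fun w : C(I, X) => (⟨fun t => F (t, w t), by fun_prop⟩ : C(I, Y)) :=
  ContinuousMap.continuous_of_continuous_uncurry _
    (hF.comp (continuous_snd.prodMk continuous_eval))

theorem inner_symm_apply_nonneg_of_strictMono {X : Type*} [NormedAddCommGroup X]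
    [InnerProductSpace ℝ X] {φ : X ≃ₜ X} (hφ0 : φ 0 = 0)
    (hφmono : ∀ x y : X, x ≠ y → 0 < inner ℝ (φ x - φ y) (x - y)) (v : X) :
    0 ≤ inner ℝ v (φ.symm v) := by
  by_cases hv : φ.symm v = 0
  · simp [hv]
  · simpa [hφ0] using (hφmono _ 0 hv).le

/-- An a priori bound: if `‖g‖ ≤ ⟪g, u⟫ + h` where `u' = w`, `u(T) = 0`, and the primitive `v` of `g`
vanishing at `0` satisfies `⟪v, w⟫ ≥ 0`, then `‖v‖ ≤ ∫ h`. -/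
theorem norm_primitiveExtend_le_integral {X : Type*} [NormedAddCommGroup X]
    [InnerProductSpace ℝ X] [CompleteSpace X] {T : ℝ} (hT : 0 ≤ T) {g w : C(Icc 0 T, X)}
    {h : ℝ → ℝ} (hh : ContinuousOn h (Icc 0 T))
    (hbound : ∀ t : Icc 0 T,
      ‖g t‖ ≤ inner ℝ (g t) (w.primitiveExtend hT t - w.primitiveExtend hT T) + h t)
    (hmono : ∀ t : Icc 0 T, 0 ≤ inner ℝ (g.primitiveExtend hT t) (w t))
    {t : ℝ} (ht : t ∈ Icc 0 T) : ‖g.primitiveExtend hT t‖ ≤ ∫ s in (0)..T, h s := by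
  let u : ℝ → X := fun t => w.primitiveExtend hT t - w.primitiveExtend hT T
  let v := g.primitiveExtend hT
  let g' := g.IccExtend hT
  let w' := w.IccExtend hT
  have hu : Continuous u := (w.continuous_primitiveExtend hT).sub continuous_const
  have hv : Continuous v := g.continuous_primitiveExtend hT
  have hg' : Continuous g' := g'.continuous
  have hw' : Continuous w' := w'.continuous
  have hder : ∀ s, HasDerivAt (fun s => inner ℝ (v s) (u s))
      (inner ℝ (v s) (w' s) + inner ℝ (g' s) (u s)) s := fun s =>
    (g.hasDerivAt_primitiveExtend hT s).inner ℝ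
      ((w.hasDerivAt_primitiveExtend hT s).sub_const _)
  have hc1 : Continuous fun s => (inner ℝ (v s) (w' s) : ℝ) := hv.inner hw'
  have hc2 : Continuous fun s => (inner ℝ (g' s) (u s) : ℝ) := hg'.inner hu
  have hhi : IntervalIntegrable h volume 0 T := hh.intervalIntegrable_of_Icc hT
  have hparts := intervalIntegral.integral_eq_sub_of_hasDerivAt (fun s _ => hder s)
    ((hc1.add hc2).intervalIntegrable 0 T)
  rw [intervalIntegral.integral_add (hc1.intervalIntegrable _ _) (hc2.intervalIntegrable _ _)]
    at hparts
  have hvw : 0 ≤ ∫ s in (0)..T, (inner ℝ (v s) (w' s) : ℝ) :=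
    intervalIntegral.integral_nonneg hT fun s hs => by
      have := hmono ⟨s, hs⟩
      rwa [← ContinuousMap.IccExtend_apply_of_mem hT w hs] at this
  have hbdry : (inner ℝ (v T) (u T) : ℝ) - inner ℝ (v 0) (u 0) = 0 := by simp [u, v]
  calc ‖v t‖ ≤ ∫ s in (0)..t, ‖g' s‖ := intervalIntegral.norm_integral_le_integral_norm ht.1
    _ ≤ ∫ s in (0)..T, ‖g' s‖ := intervalIntegral.integral_mono_interval le_rfl ht.1 ht.2
        (Filter.Eventually.of_forall fun s => norm_nonneg _) (hg'.norm.intervalIntegrable _ _)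
    _ ≤ ∫ s in (0)..T, ((inner ℝ (g' s) (u s) : ℝ) + h s) := by
        refine intervalIntegral.integral_mono_on hT (hg'.norm.intervalIntegrable _ _)
          ((hc2.intervalIntegrable _ _).add hhi) fun s hs => ?_
        have := hbound ⟨s, hs⟩
        rwa [← ContinuousMap.IccExtend_apply_of_mem hT g hs] at this
    _ = (∫ s in (0)..T, (inner ℝ (g' s) (u s) : ℝ)) + ∫ s in (0)..T, h s :=
        intervalIntegral.integral_add (hc2.intervalIntegrable _ _) hhi
    _ ≤ ∫ s in (0)..T, h s := by linarith

theorem isBVPSolution_of_eq_primitive {X : Type*} [NormedAddCommGroup X] [NormedSpace ℝ X]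
    [CompleteSpace X] {T : ℝ} (hT : 0 < T) {φ : X → X} {f : ℝ × X × X → X}
    {g w : C(Icc 0 T, X)} (hw0 : w ⟨0, le_rfl, hT.le⟩ = 0)
    (hφw : ∀ t : Icc 0 T, φ (w t) = g.primitiveExtend hT.le t)
    (hg : ∀ t : Icc 0 T,
      g t = f (t, w.primitiveExtend hT.le t - w.primitiveExtend hT.le T, w t)) :
    IsBVPSolution T φ f fun t => w.primitiveExtend hT.le t - w.primitiveExtend hT.le T := by
  set u : ℝ → X := fun t => w.primitiveExtend hT.le t - w.primitiveExtend hT.le T with hu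
  have hd : ∀ t (ht : t ∈ Icc 0 T), derivWithin u (Icc 0 T) t = w ⟨t, ht⟩ := fun t ht => by
    rw [← ContinuousMap.IccExtend_apply_of_mem hT.le w ht]
    exact ((w.hasDerivAt_primitiveExtend hT.le t).sub_const _).hasDerivWithinAt.derivWithin
      (uniqueDiffOn_Icc hT t ht)
  have hφd : ∀ t ∈ Icc 0 T, φ (derivWithin u (Icc 0 T) t) = g.primitiveExtend hT.le t :=
    fun t ht => by rw [hd t ht, hφw ⟨t, ht⟩]
  refine ⟨((w.contDiff_primitiveExtend hT.le).sub contDiff_const).contDiffOn,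
    (g.contDiff_primitiveExtend hT.le).contDiffOn.congr hφd, fun t ht => ?_, sub_self _, ?_⟩
  · rw [derivWithin_congr hφd (hφd t ht), hd t ht]
    have h1 := (g.hasDerivAt_primitiveExtend hT.le t).hasDerivWithinAt.derivWithin
      (uniqueDiffOn_Icc hT t ht)
    rw [h1, ContinuousMap.IccExtend_apply_of_mem hT.le g ht]
    exact hg ⟨t, ht⟩
  · rw [hd 0 ⟨le_rfl, hT.le⟩, hw0]

theorem mainTheorem3 {X : Type*} [NormedAddCommGroup X] [InnerProductSpace ℝ X] [CompleteSpace X]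
    (T : ℝ) (hT : 0 < T)
    (φ : X ≃ₜ X) (hφ0 : φ 0 = 0)
    (k : NNReal) (hφLip : LipschitzWith k φ.symm)
    (hφmono : ∀ x y : X, x ≠ y → 0 < inner ℝ (φ x - φ y) (x - y))
    (f : ℝ × X × X → X)
    (hf : IsCompletelyContinuousOn f (Set.Icc (0 : ℝ) T ×ˢ Set.univ))
    (h : ℝ → ℝ) (hcont : ContinuousOn h (Set.Icc 0 T)) (hnonneg : ∀ t ∈ Set.Icc (0 : ℝ) T, 0 ≤ h t)
    (hbound : ∀ t ∈ Set.Icc (0 : ℝ) T, ∀ x y : X,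
      ‖f (t, x, y)‖ ≤ inner ℝ (f (t, x, y)) x + h t) :
    ∃ u : ℝ → X, IsBVPSolution T φ f u := by
  let P : C(Icc 0 T, X) →L[ℝ] C(Icc 0 T, X) := ContinuousMap.primitive hT.le
  have hfc : Continuous fun p : Icc 0 T × X × X => f (p.1, p.2) :=
    hf.1.comp_continuous (by fun_prop) fun p => ⟨p.1.2, mem_univ _⟩
  let U : C(Icc 0 T, X) → C(Icc 0 T, X) := fun w =>
    P w - ContinuousMap.const _ (P w ⟨T, hT.le, le_rfl⟩)
  have hUL : LipschitzWith (‖P‖₊ + ‖P‖₊) U := by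
    refine P.lipschitz.sub (LipschitzWith.of_dist_le_mul fun x y => ?_)
    refine (ContinuousMap.dist_le (by positivity)).2 fun _ => ?_
    exact (ContinuousMap.dist_apply_le_dist (f := P x) (g := P y) ⟨T, hT.le, le_rfl⟩).trans
      (P.lipschitz.dist_le_mul x y)
  have hU : Continuous U := hUL.continuous
  let N : C(Icc 0 T, X) → C(Icc 0 T, X) := fun w =>
    ⟨fun t => f (t, (U w).prodMk w t), hfc.comp (continuous_id.prodMk ((U w).prodMk w).continuous)⟩
  have hN : Continuous N := (ContinuousMap.continuous_superposition hfc).comp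
    (ContinuousMap.continuous_of_continuous_uncurry (fun w => (U w).prodMk w)
      ((continuous_eval.comp (hU.prodMap continuous_id)).prodMk continuous_eval))
  let Φ : C(X, X) := ⟨φ.symm, φ.symm.continuous⟩
  let F : C(Icc 0 T, X) → C(Icc 0 T, X) := fun w => Φ.comp (P (N w))
  have hF : Continuous F := Φ.continuous_postcomp.comp (P.continuous.comp hN)
  have hNw : ∀ w t, N w t
      = f (t, w.primitiveExtend hT.le t - w.primitiveExtend hT.le T, w t) := fun w t => rfl
  have hFw : ∀ w t, F w t = φ.symm ((N w).primitiveExtend hT.le t) := fun w t => rfl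
  have hint : 0 ≤ ∫ s in (0)..T, h s := intervalIntegral.integral_nonneg hT.le hnonneg
  -- The a priori bound, plus `1` to keep the radius positive.
  set R : ℝ := k * (∫ s in (0)..T, h s) + 1
  have hR0 : 0 < R := by positivity
  obtain ⟨Q, hQ, hFQ⟩ : ∃ Q, IsCompact Q ∧ MapsTo F (closedBall 0 R) Q := by
    have hUb : Bornology.IsBounded (U '' closedBall 0 R) :=
      hUL.isBounded_image isBounded_closedBall
    obtain ⟨M, hM⟩ := hUb.exists_norm_le
    let B : Set (ℝ × X × X) := Icc 0 T ×ˢ (closedBall 0 M ×ˢ closedBall 0 R)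
    have hB : IsCompact (closure (f '' B)) := hf.2 B (prod_mono_right (subset_univ _))
      ((isBounded_Icc 0 T).prod (isBounded_closedBall.prod isBounded_closedBall))
    obtain ⟨Q, hQ, hPQ⟩ := ContinuousMap.exists_isCompact_primitive_mem hT.le hB
    refine ⟨Φ.comp '' Q, hQ.image Φ.continuous_postcomp, fun w hw => ?_⟩
    refine mem_image_of_mem _ (hPQ _ fun t => subset_closure (mem_image_of_mem f ⟨t.2, ?_, ?_⟩))
    · exact mem_closedBall_zero_iff.2
        (((U w).norm_coe_le_norm t).trans (hM _ (mem_image_of_mem U hw)))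
    · exact mem_closedBall_zero_iff.2
        ((w.norm_coe_le_norm t).trans (mem_closedBall_zero_iff.1 hw))
  obtain ⟨w, hw⟩ := exists_fixedPoint_of_norm_le_of_eq_smul hR0 hQ hF hFQ (by
    intro w c hc hwc
    refine (ContinuousMap.norm_le _ hR0.le).2 fun t => ?_
    have hsymm0 : φ.symm 0 = 0 := by rw [← hφ0, φ.symm_apply_apply, hφ0]
    have h1 : ‖(N w).primitiveExtend hT.le t‖ ≤ ∫ s in (0)..T, h s := by
      refine norm_primitiveExtend_le_integral hT.le (w := w) hcont
        (fun t => hbound t t.2 _ _) (fun t => ?_) t.2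
      have h2 : w t = c • φ.symm ((N w).primitiveExtend hT.le t) :=
        congrArg (fun w : C(Icc 0 T, X) => w t) hwc
      rw [h2, real_inner_smul_right]
      exact mul_nonneg hc.1 (inner_symm_apply_nonneg_of_strictMono hφ0 hφmono _)
    have h3 := hφLip.norm_sub_le ((N w).primitiveExtend hT.le t) 0
    rw [hsymm0, sub_zero, sub_zero] at h3
    rw [hFw]
    have h4 := mul_le_mul_of_nonneg_left h1 k.coe_nonneg
    exact (h3.trans h4).trans (by linarith))
  have hφw : ∀ t, φ (w t) = (N w).primitiveExtend hT.le t := fun t => by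
    rw [← φ.apply_symm_apply ((N w).primitiveExtend hT.le t), ← hFw, hw]
  refine ⟨_, isBVPSolution_of_eq_primitive hT (g := N w) (w := w) ?_ hφw (hNw w)⟩
  -- The condition at `0` is automatic: `φ (w 0) = 0 = φ 0`.
  have h0 := hφw ⟨0, le_rfl, hT.le⟩
  rw [ContinuousMap.primitiveExtend_zero, ← hφ0] at h0
  exact φ.injective h0
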